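/- Let $r\ge 2$ and $m\ge 2$ be integers. For $j_0\in\{-2r,-r\}$ let $P_{j_0,k}(c)$, $k\ge -2r$, be the polynomials in $c$ with initial values $P_{j_0,j_0}=1$ and $P_{j_0,k}=0$ for $k\in\{-2r,\dots,-1\}\setminus\{j_0\}$, and with $$(2r+m+km)\,P_{j_0,k}=2c\,(r+(1+k-r)m)\,P_{j_0,k-r}-(k-(2r-1))\,m\,P_{j_0,k-2r}\qquad(k\ge 0).$$ Let $G_{j_0}(c,v)=\sum_{k\ge 0}P_{j_0,k-2r}(c)\,z^{k}$ with $z=e^{v}$ (that is, $v=\log z$), and let $$D=\{(c,v)\in\mathbb C^2:\ 1-2cw^r+w^{2r}\ne 0\ \text{ for all } w\in\mathbb C \text{ with } |w|\le |e^{v}|\}.$$ For both values of $j_0$ the series converges on $D$ and $G_{j_0}$ is holomorphic on $D$. Moreover, on $D$: (i) with $\kappa=(m+r)^2+mr(-2r+m(r-2))$, $$\begin{aligned}0={}&m^2\Big[r^2\Big((1-c^2)\tfrac{\partial^2}{\partial c^2}-3c\tfrac{\partial}{\partial c}\Big)+\tfrac{\partial^2}{\partial v^2}+\tfrac2m\,(r+(1-2r)m)\tfrac{\partial}{\partial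 v}+\tfrac{2r}{m}(m(r-1)-r)\Big]^2G_{-2r}\\&-4r^2(m(r-1)-r)^2\,G_{-2r}-12r^2\kappa\,c\,\frac{\partial G_{-2r}}{\partial c}+4r^2\kappa\,(1-c^2)\frac{\partial^2G_{-2r}}{\partial c^2}-4r^4(m+1)\frac{\partial^2G_{-2r}}{\partial c^2};\end{aligned}$$ (ii) $$\begin{aligned}0={}&m^2\Big[r^2\Big((1-c^2)\tfrac{\partial^2}{\partial c^2}-3c\tfrac{\partial}{\partial c}\Big)+\tfrac{\partial^2}{\partial v^2}+\tfrac2m\,(r+(1-2r)m)\tfrac{\partial}{\partial v}-r^2\Big]^2G_{-r}\\&-4r^2(m+r-2mr)^2\Big((c^2-1)\tfrac{\partial^2}{\partial c^2}+3c\tfrac{\partial}{\partial c}+1\Big)G_{-r}-4r^4(m+1)\frac{\partial^2G_{-r}}{\partial c^2}.\end{aligned}$$ Here the square of a bracket means that the operator is applied twice. -/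

import Mathlib

open Polynomial

noncomputable section

namespace Superelliptic

/-- The polynomials `P_{n - 2r}(c)`, with the index shifted to start at `0`: the values with
`n < 2r` are the initial values (`1` at the index `j₀`, `0` elsewhere), and the later ones are
given by the recursion
`(2r + m + km) P_k = 2c (r + (1 + k - r) m) P_{k-r} - (k - (2r - 1)) m P_{k-2r}`, `k = n - 2r`. -/
def shiftedPoly (r m : ℕ) (j₀ : ℤ) (n : ℕ) : ℂ[X] :=
  if h : 0 < r ∧ 2 * r ≤ n then
    C ((2 * r + m + ((n : ℂ) - 2 * r) * m)⁻¹) *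
      (C (2 * (r + (1 + ((n : ℂ) - 2 * r) - r) * m)) * X * shiftedPoly r m j₀ (n - r)
        - C ((((n : ℂ) - 2 * r) - (2 * r - 1)) * m) * shiftedPoly r m j₀ (n - 2 * r))
  else if (n : ℤ) - 2 * r = j₀ then 1 else 0
termination_by n
decreasing_by all_goals omega

/-- The polynomial `P_{j₀,k}(c)`, for an integer index `k ≥ -2r`. -/
def P (r m : ℕ) (j₀ k : ℤ) : ℂ[X] := shiftedPoly r m j₀ (k + 2 * r).toNat

/-- The initial values. -/
theorem P_initial (r m : ℕ) (j₀ k : ℤ) (h₁ : -2 * (r : ℤ) ≤ k) (h₂ : k ≤ -1) :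
    P r m j₀ k = if k = j₀ then 1 else 0 := by
  rw [P, shiftedPoly, dif_neg (by omega)]
  have : (((k + 2 * r).toNat : ℕ) : ℤ) - 2 * r = k := by omega
  rw [this]

/-- The recursion, for all `k ≥ 0`. -/
theorem P_recursion (r m : ℕ) (hr : 1 ≤ r) (j₀ k : ℤ) (hk : 0 ≤ k) :
    C (2 * r + m + k * m : ℂ) * P r m j₀ k =
      2 * X * C (r + (1 + k - r) * m : ℂ) * P r m j₀ (k - r)
        - C ((k - (2 * r - 1)) * m : ℂ) * P r m j₀ (k - 2 * r) := by
  obtain ⟨j, rfl⟩ := Int.eq_ofNat_of_zero_le hk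
  have e0 : ((j : ℤ) + 2 * r).toNat = j + 2 * r := by omega
  have e1 : ((j : ℤ) - r + 2 * r).toNat = j + 2 * r - r := by omega
  have e2 : ((j : ℤ) - 2 * r + 2 * r).toNat = j + 2 * r - 2 * r := by omega
  have hne : (2 * r + m + (j : ℂ) * m) ≠ 0 := by
    have : 2 * r + m + j * m ≠ 0 := by positivity
    exact_mod_cast this
  have hc : ((j + 2 * r : ℕ) : ℂ) - 2 * r = j := by push_cast; ring
  have h1 : C (2 * r + m + (j : ℂ) * m) * C ((2 * r + m + (j : ℂ) * m)⁻¹) = 1 := by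
    rw [← C_mul, mul_inv_cancel₀ hne, C_1]
  simp only [P, Int.cast_natCast, e0, e1, e2]
  rw [shiftedPoly, dif_pos (by omega)]
  simp only [hc]
  rw [← mul_assoc, h1, one_mul, C_mul (a := 2)]
  have : (C (2 : ℂ)) = 2 := rfl
  rw [this]
  ring

/-- The generating function `G_{j₀}(c, v) = ∑_{k ≥ 0} P_{j₀,k-2r}(c) z ^ k` with `z = exp v`. -/
def G (r m : ℕ) (j₀ : ℤ) (c v : ℂ) : ℂ :=
  ∑' k : ℕ, (P r m j₀ ((k : ℤ) - 2 * r)).eval c * Complex.exp v ^ k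

/-- The pairs `(c, v)` for which `z = exp v` lies in the largest open disc about `0` that contains
no zero of `w ↦ 1 - 2 c w ^ r + w ^ (2r)`. -/
def domain (r : ℕ) : Set (ℂ × ℂ) :=
  {p | ∀ w : ℂ, ‖w‖ ≤ ‖Complex.exp p.2‖ → 1 - 2 * p.1 * w ^ r + w ^ (2 * r) ≠ 0}

/-- The partial derivative `∂F/∂c`. -/
def dc (F : ℂ → ℂ → ℂ) : ℂ → ℂ → ℂ := fun c v => deriv (fun c' => F c' v) c

/-- The partial derivative `∂F/∂v`. -/
def dv (F : ℂ → ℂ → ℂ) : ℂ → ℂ → ℂ := fun c v => deriv (fun v' => F c v') v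

/-- The operator
`r² ((1 - c²) ∂²/∂c² - 3c ∂/∂c) + ∂²/∂v² + (2/m) (r + (1 - 2r) m) ∂/∂v + a`. -/
def gegenbauerOp (r m : ℕ) (a : ℂ) (F : ℂ → ℂ → ℂ) : ℂ → ℂ → ℂ := fun c v =>
  (r : ℂ) ^ 2 * ((1 - c ^ 2) * dc (dc F) c v - 3 * c * dc F c v)
    + dv (dv F) c v + 2 / m * (r + (1 - 2 * r) * m) * dv F c v + a * F c v

end Superelliptic

end

open Filter Topology

noncomputable section

namespace Superelliptic

/-! Write Ω = (1 - c²)∂² - 3c∂ - 1. Only indices divisible by r contribute, and the polynomials with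
k = rn - 2r satisfy the associated Gegenbauer recurrence with l = -1/m and shift s = 2/m + 1/r - 2;
j₀ = -r and j₀ = -2r give its fundamental solutions f and g. The vector (f_{n+1}, g_{n+1}, f_n, g_n)
solves a first-order linear system in c (`fundamental_system`). Eliminating three unknowns
(`assocOp_fundamental`) leaves [(Ω + σ² - μ²)² + 4μ²Ω - 4l(l-1)∂²] p = 0, σ = n + s + l, with μ = s
+ l for f and μ = s + l + 1 for g. Since σ² - μ² is a polynomial in n, and n acts on z^(rn) as
r⁻¹∂/∂v, r²(Ω + σ² - μ²) is the bracket of the theorem; multiplication by m²r⁴ gives the two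
equations.

For convergence, 1 - 2ct + t² = (1 - αt)(1 - βt) governs the limiting recurrence. A zero-free closed
disc can be enlarged slightly, uniformly for nearby c, which gives locally uniform geometric bounds
(`tame_of_rec`). These survive ∂/∂c and multiplication by n, so the series may be differentiated
termwise (`Tame.hasFDerivAt`). -/

/-! ### From the three-term recurrence to a fourth-order differential equation. -/

/-- Elimination in a linear system of four first-order equations and its derivatives at a point:
the indexed letters are the values of the successive derivatives of the four unknowns. -/
theorem fourth_order_of_system {K : Type*} [Field K]
   (x w ν l s b0 b1 b2 b3 b4 a0 a1 a2 a3 B0 B1 B2 B3 A0 A1 A2 : K)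
   (hw : w ≠ 0) (hx : w = 1 - x^2)
   (hb1 : w * b1 = (1+s-ν)*(x*b0) + (ν+2*l-1)*B0 + (1+s)*a0)
   (hb2 : w * b2 - 2*x*b1 = (1+s-ν)*(x*b1+b0) + (ν+2*l-1)*B1 + (1+s)*a1)
   (hb3 : w * b3 - 4*x*b2 - 2*b1 = (1+s-ν)*(x*b2+2*b1) + (ν+2*l-1)*B2 + (1+s)*a2)
   (hb4 : w * b4 - 6*x*b3 - 6*b2 = (1+s-ν)*(x*b3+3*b2) + (ν+2*l-1)*B3 + (1+s)*a3)
   (ha1 : w * a1 = -(ν+s+2*l)*(x*a0) + (ν+2*l-1)*A0 - (s+2*l)*b0)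
   (ha2 : w * a2 - 2*x*a1 = -(ν+s+2*l)*(x*a1+a0) + (ν+2*l-1)*A1 - (s+2*l)*b1)
   (ha3 : w * a3 - 4*x*a2 - 2*a1 = -(ν+s+2*l)*(x*a2+2*a1) + (ν+2*l-1)*A2 - (s+2*l)*b2)
   (hB1 : w * B1 = (ν+2*l+s)*(x*B0) - ν*b0 + (1+s)*A0)
   (hB2 : w * B2 - 2*x*B1 = (ν+2*l+s)*(x*B1+B0) - ν*b1 + (1+s)*A1)
   (hB3 : w * B3 - 4*x*B2 - 2*B1 = (ν+2*l+s)*(x*B2+2*B1) - ν*b2 + (1+s)*A2)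
   (hA1 : w * A1 = (ν-1-s)*(x*A0) - ν*a0 - (s+2*l)*B0)
   (hA2 : w * A2 - 2*x*A1 = (ν-1-s)*(x*A1+A0) - ν*a1 - (s+2*l)*B1) :
   (w^2*b4 - 10*x*w*b3 + (15*x^2 - 8*w)*b2 + 9*x*b1)
     + (2*((ν+l)^2+(s+l)^2) - 2) * (w*b2-3*x*b1) + (((ν+l)^2-(s+l)^2)^2
     - 2*((ν+l)^2+(s+l)^2)+1)*b0 - 4*l*(l-1)*b2 = 0 := by
  have eb1 : b1 = ((1+s-ν)*(x*b0) + (ν+2*l-1)*B0 + (1+s)*a0)/w := by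
    field_simp
    linear_combination hb1
  have ea1 : a1 = (-(ν+s+2*l)*(x*a0) + (ν+2*l-1)*A0 - (s+2*l)*b0)/w := by
    field_simp
    linear_combination ha1
  have eB1 : B1 = ((ν+2*l+s)*(x*B0) - ν*b0 + (1+s)*A0)/w := by
    field_simp
    linear_combination hB1
  have eA1 : A1 = ((ν-1-s)*(x*A0) - ν*a0 - (s+2*l)*B0)/w := by
    field_simp
    linear_combination hA1
  have eb2 : b2 = (2*x*b1 + ((1+s-ν)*(x*b1+b0) + (ν+2*l-1)*B1 + (1+s)*a1))/w := by
    field_simp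
    linear_combination hb2
  have ea2 : a2 = (2*x*a1 + (-(ν+s+2*l)*(x*a1+a0) + (ν+2*l-1)*A1 - (s+2*l)*b1))/w := by
    field_simp
    linear_combination ha2
  have eB2 : B2 = (2*x*B1+((ν+2*l+s)*(x*B1+B0) - ν*b1 + (1+s)*A1))/w := by
    field_simp
    linear_combination hB2
  have eA2 : A2 = (2*x*A1+((ν-1-s)*(x*A1+A0) - ν*a1 - (s+2*l)*B1))/w := by
    field_simp
    linear_combination hA2
  have eb3 : b3 = (4*x*b2 + 2*b1 + ((1+s-ν)*(x*b2+2*b1) + (ν+2*l-1)*B2 + (1+s)*a2))/w := by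
    field_simp
    linear_combination hb3
  have ea3 : a3 = (4*x*a2 + 2*a1 + (-(ν+s+2*l)*(x*a2+2*a1) + (ν+2*l-1)*A2 - (s+2*l)*b2))/w := by
    field_simp
    linear_combination ha3
  have eB3 : B3 = (4*x*B2+2*B1+((ν+2*l+s)*(x*B2+2*B1) - ν*b2 + (1+s)*A2))/w := by
    field_simp
    linear_combination hB3
  have eb4 : b4 = (6*x*b3 + 6*b2 + ((1+s-ν)*(x*b3+3*b2) + (ν+2*l-1)*B3 + (1+s)*a3))/w := by
    field_simp
    linear_combination hb4
  clear hb1 hb2 hb3 hb4 ha1 ha2 ha3 hB1 hB2 hB3 hA1 hA2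
  -- Substituting from the highest derivative down leaves only b0, a0, B0, A0, in which the claim is
  -- a rational identity.
  rw [eb4, eb3, ea3, eB3, eb2, ea2, eB2, eA2, eb1, ea1, eB1, eA1]
  field_simp
  subst hx
  ring

/-- The three-term recurrence of the associated Gegenbauer polynomials with parameter `l` and
shift `s`. -/
def GegenbauerRec (s l : ℂ) (f : ℕ → ℂ[X]) : Prop :=
  ∀ n : ℕ, ((n : ℂ[X]) + 2 + C s) * f (n + 2) =
    2 * X * ((n : ℂ[X]) + 1 + C s + C l) * f (n + 1) - ((n : ℂ[X]) + C s + 2 * C l) * f n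

/-- The fundamental pair of solutions satisfies a first-order differential system. -/
theorem fundamental_system {s l : ℂ} {f g : ℕ → ℂ[X]} (hs : ∀ n : ℕ, (n : ℂ) + 2 + s ≠ 0)
    (hf : GegenbauerRec s l f) (hg : GegenbauerRec s l g)
    (f0 : f 0 = 0) (f1 : f 1 = 1) (g0 : g 0 = 1) (g1 : g 1 = 0) (n : ℕ) :
    ((1 - X ^ 2) * derivative (f (n + 1)) = -(n : ℂ[X]) * (X * f (n + 1))
      + ((n : ℂ[X]) + C s + 2 * C l) * f n + (1 + C s) * g (n + 1)) ∧
    ((1 - X ^ 2) * derivative (g (n + 1)) = -((n : ℂ[X]) + 1 + 2 * C s + 2 * C l) * (X * g (n + 1))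
      + ((n : ℂ[X]) + C s + 2 * C l) * g n - (C s + 2 * C l) * f (n + 1)) ∧
    ((1 - X ^ 2) * derivative (f n) = ((n : ℂ[X]) + 1 + 2 * C s + 2 * C l) * (X * f n)
      - ((n : ℂ[X]) + 1 + C s) * f (n + 1) + (1 + C s) * g n) ∧
    ((1 - X ^ 2) * derivative (g n) = (n : ℂ[X]) * (X * g n)
      - ((n : ℂ[X]) + 1 + C s) * g (n + 1) - (C s + 2 * C l) * f n) := by
  induction n with
  | zero =>
    simp only [zero_add, f0, f1, g0, g1, derivative_zero, derivative_one, Nat.cast_zero]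
    refine ⟨?_, ?_, ?_, ?_⟩ <;> ring
  | succ n ih =>
    obtain ⟨h1, h2, h3, h4⟩ := ih
    have rf := hf n
    have rg := hg n
    have hν : (n : ℂ[X]) + 2 + C s ≠ 0 := by
      have : (n : ℂ[X]) + 2 + C s = C ((n : ℂ) + 2 + s) := by
        simp only [map_add, map_natCast, map_ofNat]
      rw [this]
      exact C_ne_zero.2 (hs n)
    have df := congrArg derivative rf
    have dg := congrArg derivative rg
    simp only [derivative_mul, derivative_add, derivative_sub, derivative_natCast, derivative_C,
      derivative_X, derivative_one, derivative_ofNat] at df dg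
    push_cast
    refine ⟨?_, ?_, ?_, ?_⟩
    -- Multiplied by n + 2 + s, the claim follows from the recurrence and its derivative; the
    -- induction hypotheses replace the derivatives on the right.
    · refine mul_left_cancel₀ hν ?_
      linear_combination (1 - X ^ 2) * df + 2 * X * ((n : ℂ[X]) + 1 + C s + C l) * h1
        - ((n : ℂ[X]) + C s + 2 * C l) * h3 + ((n : ℂ[X]) + 1) * X * rf - (1 + C s) * rg
    · refine mul_left_cancel₀ hν ?_
      linear_combination (1 - X ^ 2) * dg + 2 * X * ((n : ℂ[X]) + 1 + C s + C l) * h2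
        - ((n : ℂ[X]) + C s + 2 * C l) * h4 + ((n : ℂ[X]) + 2 + 2 * C s + 2 * C l) * X * rg + (C s + 2 * C l) * rf
    -- The last two equations at n + 1 are the first two at n, with the index n term removed by the
    -- recurrence.
    · linear_combination h1 + rf
    · linear_combination h2 + rg

theorem eval_derivs {p : ℂ[X]} {R : ℂ[X]} (h : (1 - X ^ 2) * derivative p = R) (x : ℂ) :
    (1 - x ^ 2) * (derivative p).eval x = R.eval x ∧
    (1 - x ^ 2) * (derivative^[2] p).eval x - 2 * x * (derivative p).eval x
      = (derivative R).eval x ∧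
    (1 - x ^ 2) * (derivative^[3] p).eval x - 4 * x * (derivative^[2] p).eval x
      - 2 * (derivative p).eval x = (derivative^[2] R).eval x ∧
    (1 - x ^ 2) * (derivative^[4] p).eval x - 6 * x * (derivative^[3] p).eval x
      - 6 * (derivative^[2] p).eval x = (derivative^[3] R).eval x := by
  subst h
  simp only [Function.iterate_succ, Function.iterate_zero, Function.comp, id, derivative_mul,
    derivative_sub, derivative_add, derivative_one, pow_two, derivative_X,
    derivative_zero, eval_add, eval_mul,
    eval_sub, eval_X, eval_one, eval_zero]
  refine ⟨trivial, ?_, ?_, ?_⟩ <;> ring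

/-- The operator `(1 - c²) ∂² - 3c ∂ - 1`. -/
def chebyshevOp (p : ℂ[X]) : ℂ[X] :=
  (1 - X ^ 2) * derivative (derivative p) - 3 * X * derivative p - p

/-- The fourth-order operator annihilating associated Gegenbauer polynomials. -/
def assocOp (σ μ l : ℂ) (p : ℂ[X]) : ℂ[X] :=
  chebyshevOp (chebyshevOp p) + C (2 * (σ ^ 2 + μ ^ 2)) * chebyshevOp p
    + C ((σ ^ 2 - μ ^ 2) ^ 2) * p - C (4 * l * (l - 1)) * derivative (derivative p)

theorem assocOp_eq_zero {s l ν : ℂ} {p q P Q : ℂ[X]}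
    (hp : (1 - X ^ 2) * derivative p = C (1 + s - ν) * (X * p) + C (ν + 2 * l - 1) * P
      + C (1 + s) * q)
    (hq : (1 - X ^ 2) * derivative q = C (-(ν + s + 2 * l)) * (X * q) + C (ν + 2 * l - 1) * Q
      - C (s + 2 * l) * p)
    (hP : (1 - X ^ 2) * derivative P = C (ν + 2 * l + s) * (X * P) - C ν * p + C (1 + s) * Q)
    (hQ : (1 - X ^ 2) * derivative Q = C (ν - 1 - s) * (X * Q) - C ν * q - C (s + 2 * l) * P) :
    assocOp (ν + l) (s + l) l p = 0 := by
  -- The extra factor 1 - X² makes the points x = ±1, where the system is singular, trivial.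
  have hX : (1 - X ^ 2 : ℂ[X]) ≠ 0 := by
    intro h
    have := congrArg (eval 0) h
    simp at this
  refine mul_left_cancel₀ hX ?_
  refine Polynomial.funext fun x => ?_
  rw [mul_zero, eval_zero, eval_mul]
  by_cases hw : 1 - x ^ 2 = 0
  · simp [hw]
  obtain ⟨p1, p2, p3, p4⟩ := eval_derivs hp x
  obtain ⟨q1, q2, q3, q4⟩ := eval_derivs hq x
  obtain ⟨P1, P2, P3, P4⟩ := eval_derivs hP x
  obtain ⟨Q1, Q2, Q3, Q4⟩ := eval_derivs hQ x
  clear q4 P4 Q3 Q4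
  simp only [Function.iterate_succ, Function.iterate_zero, Function.comp, id, derivative_mul,
    derivative_sub, derivative_add, derivative_X, derivative_C,
    eval_add, eval_mul, eval_sub, eval_X, eval_one, eval_C, zero_mul,
    zero_add, one_mul] at *
  have key := fourth_order_of_system x (1 - x ^ 2) ν l s
    (p.eval x) ((derivative p).eval x) ((derivative (derivative p)).eval x)
    ((derivative (derivative (derivative p))).eval x)
    ((derivative (derivative (derivative (derivative p)))).eval x)
    (q.eval x) ((derivative q).eval x) ((derivative (derivative q)).eval x)
    ((derivative (derivative (derivative q))).eval x)
    (P.eval x) ((derivative P).eval x) ((derivative (derivative P)).eval x)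
    ((derivative (derivative (derivative P))).eval x)
    (Q.eval x) ((derivative Q).eval x) ((derivative (derivative Q)).eval x) hw rfl
    (by linear_combination p1) (by linear_combination p2) (by linear_combination p3)
    (by linear_combination p4) (by linear_combination q1) (by linear_combination q2)
    (by linear_combination q3) (by linear_combination P1) (by linear_combination P2)
    (by linear_combination P3) (by linear_combination Q1) (by linear_combination Q2)
  refine mul_eq_zero_of_right _ ?_
  simp only [assocOp, chebyshevOp, derivative_mul,
    derivative_sub, derivative_add, derivative_one, pow_two, derivative_X,
    derivative_zero, derivative_ofNat, eval_add, eval_mul,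
    eval_sub, eval_X, eval_one, eval_C, eval_zero, eval_ofNat]
  linear_combination key

/-- Both members of the fundamental pair of solutions satisfy a fourth-order equation. -/
theorem assocOp_fundamental {s l : ℂ} {f g : ℕ → ℂ[X]} (hs : ∀ n : ℕ, (n : ℂ) + 2 + s ≠ 0)
    (hf : GegenbauerRec s l f) (hg : GegenbauerRec s l g)
    (f0 : f 0 = 0) (f1 : f 1 = 1) (g0 : g 0 = 1) (g1 : g 1 = 0) (n : ℕ) :
    assocOp (n + s + l) (s + l) l (f n) = 0 ∧ assocOp (n + s + l) (s + 1 + l) l (g n) = 0 := by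
  cases n with
  | zero =>
    constructor
    · simp [f0, assocOp, chebyshevOp]
    -- For the constant 1 the equation reads 1 - (μ - σ)² = 0, and here μ - σ = 1.
    · simp only [g0, assocOp, chebyshevOp, derivative_one, derivative_zero, derivative_neg,
        mul_zero, sub_zero, zero_sub, mul_neg, mul_one, Nat.cast_zero]
      simp only [map_add, map_sub, map_mul, map_pow, map_zero, map_one, map_ofNat]
      ring
  | succ n =>
    obtain ⟨h1, h2, h3, h4⟩ := fundamental_system hs hf hg f0 f1 g0 g1 n
    push_cast
    constructor
    · refine assocOp_eq_zero (s := s) (ν := n + 1 + s) (p := f (n + 1)) (q := g (n + 1))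
        (P := f n) (Q := g n) ?_ ?_ ?_ ?_ <;>
      simp only [map_add, map_sub, map_mul, map_neg, map_ofNat, map_natCast, map_one]
      · linear_combination h1
      · linear_combination h2
      · linear_combination h3
      · linear_combination h4
    -- The substitution s ↦ -s - 2l - 1, with ν fixed, swaps 1 + s and -(s + 2l), hence the roles of
    -- f and g. It turns s + l into -(s + l + 1), which enters only squared.
    · have := assocOp_eq_zero (s := -s - 2 * l - 1) (l := l) (ν := n + 1 + s)
        (p := g (n + 1)) (q := f (n + 1)) (P := g n) (Q := f n) ?_ ?_ ?_ ?_
      · have e : (-s - 2 * l - 1 + l) ^ 2 = (s + 1 + l) ^ 2 := by ring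
        unfold assocOp at this ⊢
        rwa [e] at this
      all_goals simp only [map_add, map_sub, map_mul, map_neg, map_ofNat, map_natCast, map_one]
      · linear_combination h2
      · linear_combination h1
      · linear_combination h4
      · linear_combination h3

/-! ### Zero-free discs and growth of the coefficients. -/

/-- The pairs `(c, ρ)` such that `1 - 2 c t + t ^ 2` has no zero in the disc of radius `ρ`. -/
def zeroFree : Set (ℂ × ℝ) :=
  {p | ∀ u ∈ Metric.closedBall (0 : ℂ) 1, 1 - 2 * p.1 * (p.2 * u) + (p.2 * u) ^ 2 ≠ 0}

/-- Scaling by ρ keeps the compact set of test points fixed, so the tube lemma applies. -/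
theorem isOpen_zeroFree : IsOpen zeroFree := by
  rw [isOpen_iff_mem_nhds]
  intro p hp
  refine (isCompact_closedBall (0 : ℂ) 1).eventually_forall_of_forall_eventually fun u hu => ?_
  have hc : Continuous fun z : (ℂ × ℝ) × ℂ =>
      1 - 2 * z.1.1 * ((z.1.2 : ℂ) * z.2) + ((z.1.2 : ℂ) * z.2) ^ 2 := by fun_prop
  exact hc.continuousAt.eventually_ne (hp u hu)

/-- The map w ↦ w^r sends the closed disc of radius |z| onto that of radius |z|^r. -/
theorem mem_domain_iff {r : ℕ} (hr : 1 ≤ r) (c v : ℂ) :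
    (c, v) ∈ domain r ↔ (c, ‖Complex.exp v‖ ^ r) ∈ zeroFree := by
  have hpos : 0 < ‖Complex.exp v‖ ^ r := by
    have := norm_pos_iff.2 (Complex.exp_ne_zero v)
    positivity
  constructor
  · intro h u hu
    rw [mem_closedBall_zero_iff] at hu
    obtain ⟨w, hw⟩ := IsAlgClosed.exists_pow_nat_eq
      (((‖Complex.exp v‖ ^ r : ℝ) : ℂ) * u) (show 0 < r by omega)
    have hle : ‖w‖ ≤ ‖Complex.exp v‖ := by
      refine le_of_pow_le_pow_left₀ (show r ≠ 0 by omega) (norm_nonneg _) ?_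
      rw [← norm_pow, hw, norm_mul, Complex.norm_real, Real.norm_of_nonneg hpos.le]
      exact mul_le_of_le_one_right hpos.le hu
    have := h w hle
    rw [mul_comm 2 r, pow_mul, hw] at this
    exact this
  · intro h w hw
    have := h (w ^ r / ((‖Complex.exp v‖ ^ r : ℝ) : ℂ)) (by
      rw [mem_closedBall_zero_iff, norm_div, norm_pow, Complex.norm_real,
        Real.norm_of_nonneg hpos.le]
      exact div_le_one_of_le₀ (pow_le_pow_left₀ (norm_nonneg _) hw r) hpos.le)
    rw [mul_div_cancel₀ _ (Complex.ofReal_ne_zero.2 hpos.ne')] at this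
    rw [mul_comm 2 r, pow_mul]
    exact this

theorem isOpen_domain {r : ℕ} (hr : 1 ≤ r) : IsOpen (domain r) := by
  have hc : Continuous fun p : ℂ × ℂ => (p.1, ‖Complex.exp p.2‖ ^ r) := by fun_prop
  have : domain r = (fun p : ℂ × ℂ => (p.1, ‖Complex.exp p.2‖ ^ r)) ⁻¹' zeroFree := by
    ext ⟨c, v⟩
    exact mem_domain_iff hr c v
  rw [this]
  exact isOpen_zeroFree.preimage hc

/-- A zero-free disc about `0` for `1 - 2 c t + t ^ 2 = (1 - α t) (1 - β t)` bounds `α` and `β`. -/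
theorem exists_roots {c : ℂ} {T : ℝ} (hT : 0 < T) (h : (c, T) ∈ zeroFree) :
    ∃ α β : ℂ, α + β = 2 * c ∧ α * β = 1 ∧ ‖α‖ ≤ T⁻¹ ∧ ‖β‖ ≤ T⁻¹ := by
  have aux : ∀ α β : ℂ, α + β = 2 * c → α * β = 1 → ‖α‖ ≤ T⁻¹ := by
    intro α β h1 h2
    by_contra! hlt
    have hβ : ‖β‖ ≤ T := by
      have h3 : ‖α‖ * ‖β‖ = 1 := by rw [← norm_mul, h2, norm_one]
      have h4 : T⁻¹ * ‖β‖ ≤ 1 := by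
        rw [← h3]
        gcongr
      rwa [inv_mul_le_iff₀ hT, mul_one] at h4
    -- If |α| > 1/T, then β = 1/α is a zero of 1 - 2ct + t² with |β| ≤ T.
    refine h (β / T) ?_ ?_
    · rw [mem_closedBall_zero_iff, norm_div, Complex.norm_real, Real.norm_of_nonneg hT.le]
      exact div_le_one_of_le₀ hβ hT.le
    · simp only
      rw [mul_div_cancel₀ _ (Complex.ofReal_ne_zero.2 hT.ne')]
      linear_combination β * h1 - h2
  obtain ⟨z, hz⟩ := IsAlgClosed.exists_pow_nat_eq (c ^ 2 - 1) (show 0 < 2 by norm_num)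
  refine ⟨c + z, c - z, by ring, by linear_combination -hz, aux _ (c - z) (by ring)
    (by linear_combination -hz), aux _ (c + z) (by ring) (by linear_combination -hz)⟩

/-- A perturbed second-order recurrence grows at most like `R ^ n` for every `R` larger than the
moduli of its characteristic roots. -/
theorem growth_of_perturbed_rec {y : ℕ → ℂ} {α β : ℂ} {R₀ R η ε K : ℝ} (hR₀ : 0 < R₀) (hR : R₀ < R)
    (hηR : R₀ ≤ R * (1 - η)) (hε : ε * (R + 1) ≤ η * R * (R - R₀)) (hε0 : 0 ≤ ε)
    (hα : ‖α‖ ≤ R₀) (hβ : ‖β‖ ≤ R₀) (hαβ : α * β = 1)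
    (hrec : ∀ n, ‖y (n + 2) - (α + β) * y (n + 1) + y n‖ ≤ ε * (‖y (n + 1)‖ + ‖y n‖))
    (h0 : ‖y 0‖ ≤ K) (h1 : ‖y 1‖ ≤ K * R) (h2 : ‖y 1 - α * y 0‖ ≤ K * η * R) (n : ℕ) :
    ‖y n‖ ≤ K * R ^ n := by
  have hK : 0 ≤ K := (norm_nonneg _).trans h0
  have hRpos : 0 < R := hR₀.trans hR
  -- The unperturbed recurrence factors through d_n = y_{n+1} - αy_n, with d_{n+1} = βd_n. Tracking
  -- d_n as well makes the induction close even if α = β.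
  suffices H : ‖y n‖ ≤ K * R ^ n ∧ ‖y (n + 1)‖ ≤ K * R ^ (n + 1) ∧
      ‖y (n + 1) - α * y n‖ ≤ K * η * R ^ (n + 1) from H.1
  induction n with
  | zero => simpa using ⟨h0, h1, h2⟩
  | succ n ih =>
    obtain ⟨i0, i1, i2⟩ := ih
    have hd : ‖y (n + 2) - α * y (n + 1)‖ ≤ K * η * R ^ (n + 2) := by
      have e : y (n + 2) - α * y (n + 1) = (y (n + 2) - (α + β) * y (n + 1) + y n)
          + β * (y (n + 1) - α * y n) := by linear_combination y n * hαβ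
      have hm : ‖β‖ * ‖y (n + 1) - α * y n‖ ≤ R₀ * (K * η * R ^ (n + 1)) := by gcongr
      have hr : ε * (‖y (n + 1)‖ + ‖y n‖) ≤ ε * (K * R ^ (n + 1) + K * R ^ n) := by gcongr
      have hmul := mul_le_mul_of_nonneg_left hε (show 0 ≤ K * R ^ n by positivity)
      calc ‖y (n + 2) - α * y (n + 1)‖
          ≤ ‖y (n + 2) - (α + β) * y (n + 1) + y n‖ + ‖β‖ * ‖y (n + 1) - α * y n‖ := by
            rw [e, ← norm_mul]
            exact norm_add_le _ _
        _ ≤ ε * (K * R ^ (n + 1) + K * R ^ n) + R₀ * (K * η * R ^ (n + 1)) :=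
            add_le_add ((hrec n).trans hr) hm
        _ ≤ K * η * R ^ (n + 2) := by
            have : K * R ^ n * (η * R * (R - R₀))
              = K * η * R ^ (n + 2) - R₀ * (K * η * R ^ (n + 1)) := by ring
            rw [this] at hmul
            have : K * R ^ n * (ε * (R + 1)) = ε * (K * R ^ (n + 1) + K * R ^ n) := by ring
            linarith
    refine ⟨i1, ?_, hd⟩
    have hm : ‖α‖ * ‖y (n + 1)‖ ≤ R * (1 - η) * (K * R ^ (n + 1)) := by
      exact mul_le_mul (hα.trans hηR) i1 (norm_nonneg _) (hR₀.le.trans hηR)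
    calc ‖y (n + 2)‖ = ‖α * y (n + 1) + (y (n + 2) - α * y (n + 1))‖ := by ring_nf
      _ ≤ ‖α‖ * ‖y (n + 1)‖ + ‖y (n + 2) - α * y (n + 1)‖ := by
          rw [← norm_mul]
          exact norm_add_le _ _
      _ ≤ R * (1 - η) * (K * R ^ (n + 1)) + K * η * R ^ (n + 2) := add_le_add hm hd
      _ = K * R ^ (n + 2) := by ring

/-! ### Locally uniform geometric bounds and their stability. -/

/-- Coefficient polynomials whose generating series converges locally uniformly, with room to
spare, wherever the disc of convergence is zero-free. -/
def Tame (f : ℕ → ℂ[X]) : Prop :=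
  ∀ c : ℂ, ∀ ρ : ℝ, 0 ≤ ρ → (c, ρ) ∈ zeroFree →
    ∃ T > ρ, ∃ K : ℝ, ∀ᶠ c' in 𝓝 c, ∀ n, ‖(f n).eval c'‖ * T ^ n ≤ K

theorem Tame.add {f g : ℕ → ℂ[X]} (hf : Tame f) (hg : Tame g) : Tame fun n => f n + g n := by
  intro c ρ hρ h
  obtain ⟨T, hT, K, hK⟩ := hf c ρ hρ h
  obtain ⟨T', hT', K', hK'⟩ := hg c ρ hρ h
  refine ⟨min T T', lt_min hT hT', K + K', ?_⟩
  have h0 : 0 ≤ min T T' := (hρ.trans_lt (lt_min hT hT')).le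
  filter_upwards [hK, hK'] with c' h1 h2 n
  rw [eval_add]
  calc _ ≤ (‖(f n).eval c'‖ + ‖(g n).eval c'‖) * min T T' ^ n := by
        gcongr
        exact norm_add_le _ _
    _ = ‖(f n).eval c'‖ * min T T' ^ n + ‖(g n).eval c'‖ * min T T' ^ n := add_mul _ _ _
    _ ≤ ‖(f n).eval c'‖ * T ^ n + ‖(g n).eval c'‖ * T' ^ n := by
        gcongr
        · exact min_le_left _ _
        · exact min_le_right _ _
    _ ≤ K + K' := add_le_add (h1 n) (h2 n)

theorem Tame.mul_left {f : ℕ → ℂ[X]} (p : ℂ[X]) (hf : Tame f) : Tame fun n => p * f n := by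
  intro c ρ hρ h
  obtain ⟨T, hT, K, hK⟩ := hf c ρ hρ h
  refine ⟨T, hT, (‖p.eval c‖ + 1) * K, ?_⟩
  have hp : ∀ᶠ c' in 𝓝 c, ‖p.eval c'‖ < ‖p.eval c‖ + 1 :=
    p.continuous.norm.continuousAt.eventually_lt_const (lt_add_one _)
  have h0 : 0 < T := hρ.trans_lt hT
  filter_upwards [hK, hp] with c' h1 h2 n
  rw [eval_mul, norm_mul, mul_assoc]
  exact mul_le_mul h2.le (h1 n) (by positivity) (by positivity)

/-- Shrinking T to the midpoint of ρ and T absorbs the factor n, because n q^n is bounded for 0 ≤ q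
< 1. -/
theorem Tame.natCast_mul {f : ℕ → ℂ[X]} (hf : Tame f) : Tame fun n => (n : ℂ[X]) * f n := by
  intro c ρ hρ h
  obtain ⟨T, hT, K, hK⟩ := hf c ρ hρ h
  have h0 : 0 < T := hρ.trans_lt hT
  have hq0 : 0 ≤ ((ρ + T) / 2) / T := by positivity
  have hq1 : ((ρ + T) / 2) / T < 1 := by
    rw [div_lt_one h0]
    linarith
  obtain ⟨M, hM⟩ := (tendsto_self_mul_const_pow_of_lt_one hq0 hq1).bddAbove_range
  refine ⟨(ρ + T) / 2, by linarith, M * K, ?_⟩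
  filter_upwards [hK] with c' h1 n
  have hn := hM ⟨n, rfl⟩
  have hn0 : 0 ≤ (n : ℝ) * (((ρ + T) / 2) / T) ^ n := by positivity
  have e : ‖((n : ℂ[X]) * f n).eval c'‖ * ((ρ + T) / 2) ^ n
      = ((n : ℝ) * (((ρ + T) / 2) / T) ^ n) * (‖(f n).eval c'‖ * T ^ n) := by
    rw [eval_mul, eval_natCast, norm_mul, Complex.norm_natCast, div_pow _ T]
    field_simp
  rw [e]
  exact mul_le_mul hn (h1 n) (by positivity) (hn0.trans hn)

/-- Cauchy's estimate on circles of radius δ/2, independent of n, so T need not shrink. -/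
theorem Tame.map_derivative {f : ℕ → ℂ[X]} (hf : Tame f) : Tame fun n => derivative (f n) := by
  intro c ρ hρ h
  obtain ⟨T, hT, K, hK⟩ := hf c ρ hρ h
  have h0 : 0 < T := hρ.trans_lt hT
  obtain ⟨δ, hδ, hball⟩ := Metric.eventually_nhds_iff_ball.1 hK
  refine ⟨T, hT, K / (δ / 2), ?_⟩
  filter_upwards [Metric.ball_mem_nhds c (half_pos hδ)] with c' hc' n
  have hb : ∀ z ∈ Metric.sphere c' (δ / 2), ‖(f n).eval z‖ ≤ K / T ^ n := by
    intro z hz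
    rw [le_div_iff₀ (by positivity)]
    refine hball z ?_ n
    rw [Metric.mem_ball] at hc' ⊢
    rw [Metric.mem_sphere] at hz
    linarith [dist_triangle z c' c]
  have := Complex.norm_deriv_le_of_forall_mem_sphere_norm_le (half_pos hδ)
    (f n).differentiable.diffContOnCl hb
  rw [Polynomial.deriv] at this
  calc _ ≤ K / T ^ n / (δ / 2) * T ^ n := by gcongr
    _ = K / (δ / 2) := by field_simp

/-- The recurrence differs from y_{n+2} - 2c y_{n+1} + y_n = 0 by a term with factor 2(l-1)/(n+2+s),
which tends to 0. So `growth_of_perturbed_rec` applies from some index L on, and the earlier terms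
are bounded by continuity. -/
theorem tame_of_rec {s l : ℂ} {f : ℕ → ℂ[X]} (hs : ∀ n : ℕ, (n : ℂ) + 2 + s ≠ 0)
    (hf : GegenbauerRec s l f) : Tame f := by
  intro c ρ hρ h
  have hev : ∀ᶠ p : ℂ × ℝ in 𝓝 c ×ˢ 𝓝 ρ, p ∈ zeroFree := by
    rw [← nhds_prod_eq]
    exact isOpen_zeroFree.mem_nhds h
  obtain ⟨pa, hpa, pb, hpb, hab⟩ := eventually_prod_iff.1 hev
  obtain ⟨T₁, hT₁, hρT₁⟩ := ((hpb.filter_mono nhdsWithin_le_nhds).and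
    (self_mem_nhdsWithin : Set.Ioi ρ ∈ 𝓝[>] ρ)).exists
  have hT₁0 : 0 < T₁ := hρ.trans_lt hρT₁
  set T := (ρ + T₁) / 2 with hTdef
  have hT0 : 0 < T := by rw [hTdef]; linarith
  have hTT₁ : T < T₁ := by rw [hTdef]; linarith
  set R₀ := T₁⁻¹
  set R := T⁻¹ with hRdef
  have hR₀ : 0 < R₀ := inv_pos.2 hT₁0
  have hRR : R₀ < R := by
    rw [hRdef]
    exact inv_strictAnti₀ hT0 hTT₁
  have hR : 0 < R := hR₀.trans hRR
  -- This η makes R(1 - η) = R₀; ε below is the largest value allowed by the growth lemma.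
  set η := (R - R₀) / R with hη
  have hη0 : 0 < η := div_pos (by linarith) hR
  have hηR : R₀ ≤ R * (1 - η) := by
    rw [hη]
    field_simp
    linarith
  set ε := η * R * (R - R₀) / (R + 1) with hεdef
  have hRR' : 0 < R - R₀ := by linarith
  have hε0 : 0 < ε := by positivity
  have hε : ε * (R + 1) ≤ η * R * (R - R₀) := by
    rw [hεdef]
    field_simp
    exact le_rfl
  -- the recurrence is eventually a small perturbation
  have htend : Tendsto (fun n : ℕ => (‖2 * (l - 1)‖ * (‖c‖ + 1)) * ‖((n : ℂ) + 2 + s)⁻¹‖)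
      atTop (𝓝 0) := by
    have h1 : Tendsto (fun n : ℕ => (n : ℂ) + (2 + s)) atTop (Bornology.cobounded ℂ) :=
      (tendsto_add_const_cobounded (2 + s)).comp tendsto_natCast_atTop_cobounded
    have h2 := (tendsto_inv₀_cobounded.comp h1).norm.const_mul (‖2 * (l - 1)‖ * (‖c‖ + 1))
    simpa [Function.comp_def, add_assoc] using h2
  obtain ⟨L, hL⟩ := eventually_atTop.1 (htend.eventually_le_const hε0)
  set M := ∑ n ∈ Finset.range (L + 2), (‖(f n).eval c‖ + 1) with hM
  have hM0 : 0 ≤ M := Finset.sum_nonneg fun n _ => by positivity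
  have hbd : ∀ᶠ c' in 𝓝 c, ∀ n ∈ Finset.range (L + 2), ‖(f n).eval c'‖ ≤ M := by
    rw [Finset.eventually_all]
    intro n hn
    have : ‖(f n).eval c‖ + 1 ≤ M :=
      Finset.single_le_sum (f := fun n => ‖(f n).eval c‖ + 1) (fun n _ => by positivity) hn
    filter_upwards [(f n).continuous.norm.continuousAt.eventually_lt_const (lt_add_one _)]
      with c' hc'
    exact hc'.le.trans this
  have hcb : ∀ᶠ c' in 𝓝 c, ‖c'‖ < ‖c‖ + 1 :=
    continuous_norm.continuousAt.eventually_lt_const (lt_add_one _)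
  -- The three summands serve the three initial bounds: on y 0, on y 1 and on y 1 - α y 0.
  set K := M * (1 + R⁻¹ + (1 + R₀) / (η * R)) with hK
  refine ⟨T, by rw [hTdef]; linarith, M * (1 + T) ^ L + K * T ^ L, ?_⟩
  filter_upwards [hpa, hbd, hcb] with c' hc1 hc2 hc3 n
  obtain ⟨α, β, hsum, hprod, hα, hβ⟩ := exists_roots hT₁0 (hab hc1 hT₁)
  have hL0 : ‖(f L).eval c'‖ ≤ M := hc2 _ (by simp)
  have hL1 : ‖(f (L + 1)).eval c'‖ ≤ M := hc2 _ (by simp)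
  have hgrow := growth_of_perturbed_rec (y := fun n => (f (L + n)).eval c') (K := K)
    hR₀ hRR hηR hε
    hε0.le hα hβ hprod ?_ ?_ ?_ ?_
  · have hK0 : 0 ≤ K := by positivity
    rcases lt_or_ge n L with hn | hn
    · calc ‖(f n).eval c'‖ * T ^ n ≤ M * (1 + T) ^ L := by
            gcongr
            · exact hc2 n (by simp; omega)
            · exact (pow_le_pow_left₀ hT0.le (by linarith) n).trans
                (pow_le_pow_right₀ (by linarith) hn.le)
        _ ≤ _ := le_add_of_nonneg_right (by positivity)
    · obtain ⟨k, rfl⟩ := Nat.exists_eq_add_of_le hn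
      calc ‖(f (L + k)).eval c'‖ * T ^ (L + k) ≤ K * R ^ k * T ^ (L + k) := by
            gcongr
            exact hgrow k
        _ = K * T ^ L := by
            rw [hRdef, inv_pow, pow_add]
            field_simp
        _ ≤ _ := le_add_of_nonneg_left (by positivity)
  · intro n
    have hr := congrArg (eval c') (hf (L + n))
    simp only [eval_mul, eval_add, eval_sub, eval_natCast, eval_C, eval_X, eval_one,
      eval_ofNat] at hr
    have hne := hs (L + n)
    have hsmall := hL (L + n) (by omega)
    have e : (f (L + (n + 2))).eval c' - (α + β) * (f (L + (n + 1))).eval c' + (f (L + n)).eval c'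
        = 2 * (l - 1) * (((L + n : ℕ) : ℂ) + 2 + s)⁻¹ *
          (c' * (f (L + (n + 1))).eval c' - (f (L + n)).eval c') := by
      rw [hsum]
      field_simp
      simp only [← add_assoc] at hr ⊢
      linear_combination hr
    rw [e, norm_mul, norm_mul]
    calc _ ≤ ‖2 * (l - 1)‖ * ‖(((L + n : ℕ) : ℂ) + 2 + s)⁻¹‖ *
          ((‖c‖ + 1) * (‖(f (L + (n + 1))).eval c'‖ + ‖(f (L + n)).eval c'‖)) := by
          gcongr
          calc _ ≤ ‖c'‖ * ‖(f (L + (n + 1))).eval c'‖ + 1 * ‖(f (L + n)).eval c'‖ := by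
                rw [← norm_mul, one_mul]
                exact norm_sub_le _ _
            _ ≤ (‖c‖ + 1) * ‖(f (L + (n + 1))).eval c'‖ + (‖c‖ + 1) * ‖(f (L + n)).eval c'‖ := by
                gcongr
                linarith [norm_nonneg c]
            _ = _ := by ring
      _ = ((‖2 * (l - 1)‖ * (‖c‖ + 1)) * ‖(((L + n : ℕ) : ℂ) + 2 + s)⁻¹‖) *
          (‖(f (L + (n + 1))).eval c'‖ + ‖(f (L + n)).eval c'‖) := by ring
      _ ≤ _ := by gcongr
  · refine hL0.trans ?_
    refine le_mul_of_one_le_right hM0 ?_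
    have : 0 ≤ R⁻¹ + (1 + R₀) / (η * R) := by positivity
    linarith
  · refine hL1.trans ?_
    rw [hK, mul_assoc]
    refine le_mul_of_one_le_right hM0 ?_
    have : (1 + R⁻¹ + (1 + R₀) / (η * R)) * R = R + 1 + (1 + R₀) / η := by field_simp
    rw [this]
    have : 0 ≤ (1 + R₀) / η := by positivity
    linarith
  · calc _ ≤ ‖(f (L + 1)).eval c'‖ + ‖α‖ * ‖(f L).eval c'‖ := by
          rw [← norm_mul]
          exact norm_sub_le _ _
      _ ≤ M + R₀ * M := by gcongr
      _ = M * (1 + R₀) := by ring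
      _ ≤ K * η * R := by
          rw [hK, mul_assoc, mul_assoc]
          gcongr
          have : (1 + R⁻¹ + (1 + R₀) / (η * R)) * (η * R) = η * R + η + (1 + R₀) := by field_simp
          rw [this]
          have : 0 ≤ η * R + η := by positivity
          linarith

/-! ### Termwise differentiation of the generating series. -/

/-- The generating series `∑ fₙ(c) z ^ (r n)`, `z = exp v`. -/
def genSeries (r : ℕ) (f : ℕ → ℂ[X]) (c v : ℂ) : ℂ :=
  ∑' n : ℕ, (f n).eval c * Complex.exp v ^ (r * n)

/-- The coefficients of the `v`-derivative of a generating series. -/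
def dvCoeff (r : ℕ) (f : ℕ → ℂ[X]) (n : ℕ) : ℂ[X] := C (r : ℂ) * ((n : ℂ[X]) * f n)

theorem Tame.map_dvCoeff {f : ℕ → ℂ[X]} (hf : Tame f) (r : ℕ) : Tame (dvCoeff r f) :=
  hf.natCast_mul.mul_left _

theorem Tame.eventually_bound {r : ℕ} (hr : 1 ≤ r) {f : ℕ → ℂ[X]} (hf : Tame f) {c v : ℂ}
    (h : (c, v) ∈ domain r) : ∃ u : ℕ → ℝ, Summable u ∧
      ∀ᶠ p : ℂ × ℂ in 𝓝 (c, v), ∀ n, ‖(f n).eval p.1 * Complex.exp p.2 ^ (r * n)‖ ≤ u n := by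
  set ρ := ‖Complex.exp v‖ ^ r with hρ
  have hρ0 : 0 ≤ ρ := by positivity
  obtain ⟨T, hT, K, hK⟩ := hf c ρ hρ0 ((mem_domain_iff hr c v).1 h)
  have hT0 : 0 < T := hρ0.trans_lt hT
  -- Near (c, v) the quantity |z|^r stays below the midpoint of ρ and T, which gives a geometric
  -- majorant.
  refine ⟨fun n => K * (((ρ + T) / 2) / T) ^ n, ?_, ?_⟩
  · refine (summable_geometric_of_lt_one (by positivity) ?_).mul_left K
    rw [div_lt_one hT0]
    linarith
  · have hv : ∀ᶠ p : ℂ × ℂ in 𝓝 (c, v), ‖Complex.exp p.2‖ ^ r < (ρ + T) / 2 := by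
      have hc : Continuous fun p : ℂ × ℂ => ‖Complex.exp p.2‖ ^ r := by fun_prop
      refine hc.continuousAt.eventually_lt_const ?_
      change ρ < (ρ + T) / 2
      linarith
    have hc : ∀ᶠ p : ℂ × ℂ in 𝓝 (c, v), ∀ n, ‖(f n).eval p.1‖ * T ^ n ≤ K :=
      (continuous_fst.tendsto (c, v)).eventually hK
    filter_upwards [hv, hc] with p h1 h2 n
    rw [norm_mul, norm_pow, pow_mul]
    calc _ ≤ ‖(f n).eval p.1‖ * ((ρ + T) / 2) ^ n := by gcongr
      _ = (‖(f n).eval p.1‖ * T ^ n) * (((ρ + T) / 2) / T) ^ n := by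
        rw [div_pow _ T]
        field_simp
      _ ≤ _ := by
        gcongr
        exact h2 n

theorem Tame.summable {r : ℕ} (hr : 1 ≤ r) {f : ℕ → ℂ[X]} (hf : Tame f) {c v : ℂ}
    (h : (c, v) ∈ domain r) :
    Summable fun n => (f n).eval c * Complex.exp v ^ (r * n) := by
  obtain ⟨u, hu, hb⟩ := hf.eventually_bound hr h
  exact hu.of_norm_bounded hb.self_of_nhds

/-- The majorants for both partial derivatives hold on one ball, so joint holomorphy and both
termwise formulas come out together. -/
theorem Tame.hasFDerivAt {r : ℕ} (hr : 1 ≤ r) {f : ℕ → ℂ[X]} (hf : Tame f) {c v : ℂ}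
    (h : (c, v) ∈ domain r) :
    HasFDerivAt (fun p : ℂ × ℂ => genSeries r f p.1 p.2)
      (genSeries r (fun n => derivative (f n)) c v • ContinuousLinearMap.fst ℂ ℂ ℂ
        + genSeries r (dvCoeff r f) c v • ContinuousLinearMap.snd ℂ ℂ ℂ) (c, v) := by
  obtain ⟨u₁, hu₁, hb₁⟩ := hf.map_derivative.eventually_bound hr h
  obtain ⟨u₂, hu₂, hb₂⟩ := (hf.map_dvCoeff r).eventually_bound hr h
  obtain ⟨δ, hδ, hball⟩ := Metric.eventually_nhds_iff_ball.1 (hb₁.and hb₂)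
  have key := hasFDerivAt_tsum_of_isPreconnected (𝕜 := ℂ) (hu₁.add hu₂)
    (f := fun n (p : ℂ × ℂ) => (f n).eval p.1 * Complex.exp p.2 ^ (r * n))
    (f' := fun n (p : ℂ × ℂ) =>
      ((derivative (f n)).eval p.1 * Complex.exp p.2 ^ (r * n)) • ContinuousLinearMap.fst ℂ ℂ ℂ
      + ((dvCoeff r f n).eval p.1 * Complex.exp p.2 ^ (r * n)) •
        ContinuousLinearMap.snd ℂ ℂ ℂ)
    (s := Metric.ball (c, v) δ) (x₀ := (c, v)) (x := (c, v)) Metric.isOpen_ball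
    (convex_ball _ _).isPreconnected ?_ ?_ (Metric.mem_ball_self hδ)
    (hf.summable hr h) (Metric.mem_ball_self hδ)
  · have s₁ := (hf.map_derivative.summable hr h).hasSum
    have s₂ := ((hf.map_dvCoeff r).summable hr h).hasSum
    exact key.congr_fderiv ((s₁.smul_const (ContinuousLinearMap.fst ℂ ℂ ℂ)).add
      (s₂.smul_const (ContinuousLinearMap.snd ℂ ℂ ℂ))).tsum_eq
  · intro n p _
    have h1 : HasFDerivAt (fun p : ℂ × ℂ => (f n).eval p.1)
        ((derivative (f n)).eval p.1 • ContinuousLinearMap.fst ℂ ℂ ℂ) p :=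
      ((f n).hasDerivAt p.1).comp_hasFDerivAt p hasFDerivAt_fst
    have h2 : HasFDerivAt (fun p : ℂ × ℂ => Complex.exp p.2 ^ (r * n))
        ((((r * n : ℕ) : ℂ) * Complex.exp p.2 ^ (r * n)) • ContinuousLinearMap.snd ℂ ℂ ℂ) p := by
      have e : (fun z : ℂ => Complex.exp z ^ (r * n)) = fun z => Complex.exp ((r * n : ℕ) * z) := by
        funext z
        rw [Complex.exp_nat_mul]
      have h3 : HasDerivAt (fun z : ℂ => Complex.exp z ^ (r * n))
          (((r * n : ℕ) : ℂ) * Complex.exp p.2 ^ (r * n)) p.2 := by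
        rw [e, ← Complex.exp_nat_mul]
        exact ((hasDerivAt_id p.2).const_mul ((r * n : ℕ) : ℂ)).cexp.congr_deriv
          (by rw [mul_one, mul_comm]; rfl)
      exact h3.comp_hasFDerivAt p hasFDerivAt_snd
    refine (h1.mul h2).congr_fderiv ?_
    ext <;> simp [dvCoeff] <;> ring
  · intro n p hp
    obtain ⟨b₁, b₂⟩ := hball p hp
    refine (norm_add_le _ _).trans (add_le_add ?_ ?_)
    · rw [norm_smul]
      exact (mul_le_of_le_one_right (norm_nonneg _) (ContinuousLinearMap.norm_fst_le ..)).trans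
        (b₁ n)
    · rw [norm_smul]
      exact (mul_le_of_le_one_right (norm_nonneg _) (ContinuousLinearMap.norm_snd_le ..)).trans
        (b₂ n)

theorem dc_genSeries {r : ℕ} (hr : 1 ≤ r) {f : ℕ → ℂ[X]} (hf : Tame f) {c v : ℂ}
    (h : (c, v) ∈ domain r) :
    dc (genSeries r f) c v = genSeries r (fun n => derivative (f n)) c v := by
  have := (hf.hasFDerivAt hr h).comp_hasDerivAt c ((hasDerivAt_id c).prodMk (hasDerivAt_const c v))
  simpa [dc, Function.comp_def] using this.deriv

theorem dv_genSeries {r : ℕ} (hr : 1 ≤ r) {f : ℕ → ℂ[X]} (hf : Tame f) {c v : ℂ}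
    (h : (c, v) ∈ domain r) :
    dv (genSeries r f) c v = genSeries r (dvCoeff r f) c v := by
  have := (hf.hasFDerivAt hr h).comp_hasDerivAt v ((hasDerivAt_const v c).prodMk (hasDerivAt_id v))
  simpa [dv, Function.comp_def] using this.deriv

/-- Identities valid only on the open domain can be differentiated again; this is what allows
operators to be iterated. -/
theorem dc_congr {r : ℕ} (hr : 1 ≤ r) {F H : ℂ → ℂ → ℂ}
    (hFH : ∀ c v, (c, v) ∈ domain r → F c v = H c v) {c v : ℂ} (h : (c, v) ∈ domain r) :
    dc F c v = dc H c v := by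
  refine EventuallyEq.deriv_eq ?_
  have : ContinuousAt (fun c' : ℂ => (c', v)) c := by fun_prop
  filter_upwards [this.eventually_mem ((isOpen_domain hr).mem_nhds h)] with c' hc'
  exact hFH c' v hc'

theorem dv_congr {r : ℕ} (hr : 1 ≤ r) {F H : ℂ → ℂ → ℂ}
    (hFH : ∀ c v, (c, v) ∈ domain r → F c v = H c v) {c v : ℂ} (h : (c, v) ∈ domain r) :
    dv F c v = dv H c v := by
  refine EventuallyEq.deriv_eq ?_
  have : ContinuousAt (fun v' : ℂ => (c, v')) v := by fun_prop
  filter_upwards [this.eventually_mem ((isOpen_domain hr).mem_nhds h)] with v' hv'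
  exact hFH c v' hv'

theorem dc_dc_genSeries {r : ℕ} (hr : 1 ≤ r) {f : ℕ → ℂ[X]} (hf : Tame f) {c v : ℂ}
    (h : (c, v) ∈ domain r) :
    dc (dc (genSeries r f)) c v = genSeries r (fun n => derivative (derivative (f n))) c v := by
  rw [dc_congr hr (fun _ _ => dc_genSeries hr hf) h, dc_genSeries hr hf.map_derivative h]

theorem dv_dv_genSeries {r : ℕ} (hr : 1 ≤ r) {f : ℕ → ℂ[X]} (hf : Tame f) {c v : ℂ}
    (h : (c, v) ∈ domain r) :
    dv (dv (genSeries r f)) c v = genSeries r (dvCoeff r (dvCoeff r f)) c v := by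
  rw [dv_congr hr (fun _ _ => dv_genSeries hr hf) h, dv_genSeries hr (hf.map_dvCoeff r) h]

theorem genSeries_add {r : ℕ} (hr : 1 ≤ r) {f g : ℕ → ℂ[X]} (hf : Tame f) (hg : Tame g) {c v : ℂ}
    (h : (c, v) ∈ domain r) :
    genSeries r (fun n => f n + g n) c v = genSeries r f c v + genSeries r g c v := by
  rw [genSeries, genSeries, genSeries, ← (hf.summable hr h).tsum_add (hg.summable hr h)]
  simp only [eval_add, add_mul]

theorem genSeries_mul_left (r : ℕ) (p : ℂ[X]) (f : ℕ → ℂ[X]) (c v : ℂ) :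
    genSeries r (fun n => p * f n) c v = p.eval c * genSeries r f c v := by
  rw [genSeries, genSeries, ← tsum_mul_left]
  simp only [eval_mul, mul_assoc]

theorem gegenbauerOp_congr {r : ℕ} (hr : 1 ≤ r) (m : ℕ) (a : ℂ) {F H : ℂ → ℂ → ℂ}
    (hFH : ∀ c v, (c, v) ∈ domain r → F c v = H c v) {c v : ℂ} (h : (c, v) ∈ domain r) :
    gegenbauerOp r m a F c v = gegenbauerOp r m a H c v := by
  have h1 := fun c v => dc_congr (c := c) (v := v) hr hFH
  have h2 := fun c v => dv_congr (c := c) (v := v) hr hFH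
  rw [gegenbauerOp, gegenbauerOp, dc_congr hr h1 h, dv_congr hr h2 h, h1 c v h, h2 c v h, hFH c v h]

/-! ### The differential operators on coefficients. -/

/-- The action of `gegenbauerOp` on the coefficients of a generating series. -/
def opCoeff (r m : ℕ) (a : ℂ) (f : ℕ → ℂ[X]) (n : ℕ) : ℂ[X] :=
  (C ((r : ℂ) ^ 2) * (1 - X ^ 2)) * derivative (derivative (f n))
    + ((C (-3 * (r : ℂ) ^ 2) * X) * derivative (f n)
    + (dvCoeff r (dvCoeff r f) n + (C (2 / m * (r + (1 - 2 * r) * m) : ℂ) * dvCoeff r f n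
    + C a * f n)))

theorem Tame.map_opCoeff {f : ℕ → ℂ[X]} (hf : Tame f) (r m : ℕ) (a : ℂ) : Tame (opCoeff r m a f) :=
  (hf.map_derivative.map_derivative.mul_left _).add <| (hf.map_derivative.mul_left _).add <|
    ((hf.map_dvCoeff r).map_dvCoeff r).add <| ((hf.map_dvCoeff r).mul_left _).add (hf.mul_left _)

theorem gegenbauerOp_genSeries {r : ℕ} (hr : 1 ≤ r) (m : ℕ) (a : ℂ) {f : ℕ → ℂ[X]} (hf : Tame f)
    {c v : ℂ} (h : (c, v) ∈ domain r) :
    gegenbauerOp r m a (genSeries r f) c v = genSeries r (opCoeff r m a f) c v := by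
  have t₁ := hf.mul_left (C a)
  have t₂ := ((hf.map_dvCoeff r).mul_left (C (2 / m * (r + (1 - 2 * r) * m) : ℂ))).add t₁
  have t₃ := ((hf.map_dvCoeff r).map_dvCoeff r).add t₂
  have t₄ := (hf.map_derivative.mul_left (C (-3 * (r : ℂ) ^ 2) * X)).add t₃
  have t₅ := hf.map_derivative.map_derivative.mul_left (C ((r : ℂ) ^ 2) * (1 - X ^ 2))
  have e := genSeries_add hr t₅ t₄ h
  rw [genSeries_add hr (hf.map_derivative.mul_left _) t₃ h,
    genSeries_add hr ((hf.map_dvCoeff r).map_dvCoeff r) t₂ h,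
    genSeries_add hr ((hf.map_dvCoeff r).mul_left _) t₁ h] at e
  simp only [genSeries_mul_left] at e
  rw [gegenbauerOp, dc_dc_genSeries hr hf h, dv_dv_genSeries hr hf h, dc_genSeries hr hf h,
    dv_genSeries hr hf h]
  refine Eq.trans ?_ e.symm
  simp only [eval_mul, eval_sub, eval_pow, eval_one, eval_C, eval_X]
  ring

theorem chebyshevOp_add (p q : ℂ[X]) :
    chebyshevOp (p + q) = chebyshevOp p + chebyshevOp q := by
  simp only [chebyshevOp, derivative_add]
  ring

theorem chebyshevOp_C_mul (a : ℂ) (p : ℂ[X]) : chebyshevOp (C a * p) = C a * chebyshevOp p := by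
  simp only [chebyshevOp, derivative_C_mul]
  ring

/-- On the n-th term ∂/∂v is the scalar rn. The summand 1 compensates the -1 in `chebyshevOp`. -/
theorem opCoeff_eq {r : ℕ} (hr : 1 ≤ r) (m : ℕ) (a : ℂ) (f : ℕ → ℂ[X]) (n : ℕ) :
    opCoeff r m a f n = C ((r : ℂ) ^ 2) * (chebyshevOp (f n)
      + C (1 + n ^ 2 + 2 / m * (r + (1 - 2 * r) * m) * n / r + a / r ^ 2) * f n) := by
  have hr0 : (r : ℂ) ≠ 0 := Nat.cast_ne_zero.2 (by omega)
  have e : (r : ℂ) ^ 2 * (1 + n ^ 2 + 2 / m * (r + (1 - 2 * r) * m) * n / r + a / r ^ 2)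
      = r ^ 2 + r ^ 2 * n ^ 2 + 2 / m * (r + (1 - 2 * r) * m) * r * n + a := by
    field_simp
  rw [mul_add, ← mul_assoc (C _) (C _), ← C_mul, e]
  simp only [opCoeff, dvCoeff, chebyshevOp, C_add, C_mul, C_pow, C_neg, map_natCast, map_ofNat]
  ring

theorem opCoeff_opCoeff {r : ℕ} (hr : 1 ≤ r) (m : ℕ) (a : ℂ) (f : ℕ → ℂ[X]) (n : ℕ) {δ : ℂ}
    (hδ : δ = 1 + n ^ 2 + 2 / m * (r + (1 - 2 * r) * m) * n / r + a / r ^ 2) :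
    opCoeff r m a (opCoeff r m a f) n = C ((r : ℂ) ^ 4) * (chebyshevOp (chebyshevOp (f n))
      + C (2 * δ) * chebyshevOp (f n) + C (δ ^ 2) * f n) := by
  rw [opCoeff_eq hr, opCoeff_eq hr, ← hδ, chebyshevOp_C_mul, chebyshevOp_add, chebyshevOp_C_mul]
  simp only [C_mul, C_pow, map_ofNat]
  ring

/-! ### The superelliptic coefficients as associated Gegenbauer polynomials. -/

/-- The coefficients of `G`, without the zeros. -/
def coeff (r m : ℕ) (j₀ : ℤ) (n : ℕ) : ℂ[X] := P r m j₀ (r * n - 2 * r)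

/-- The recursion moves by r and 2r, so it preserves residue classes mod r. -/
theorem shiftedPoly_eq_zero {r m : ℕ} {j₀ : ℤ} (hr : 1 ≤ r) (hj : (r : ℤ) ∣ j₀) (n : ℕ)
    (hn : ¬ r ∣ n) : shiftedPoly r m j₀ n = 0 := by
  induction n using Nat.strong_induction_on with
  | _ n ih =>
    rw [shiftedPoly]
    split_ifs with h h'
    · have d1 : ¬ r ∣ n - r := fun hd => hn (by
        have := hd.add (dvd_refl r)
        rwa [Nat.sub_add_cancel (by omega)] at this)
      have d2 : ¬ r ∣ n - 2 * r := fun hd => hn (by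
        have := hd.add (Dvd.intro_left 2 rfl : r ∣ 2 * r)
        rwa [Nat.sub_add_cancel h.2] at this)
      rw [ih _ (by omega) d1, ih _ (by omega) d2, mul_zero, mul_zero, sub_zero, mul_zero]
    · refine absurd ?_ hn
      have : (r : ℤ) ∣ (n : ℤ) := by
        have e : (n : ℤ) = j₀ + 2 * r := by omega
        rw [e]
        exact dvd_add hj (Dvd.intro_left 2 rfl)
      exact_mod_cast this
    · rfl

theorem P_eq_zero {r m : ℕ} {j₀ : ℤ} (hr : 1 ≤ r) (hj : (r : ℤ) ∣ j₀) (k : ℕ)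
    (hk : k ∉ Set.range fun n : ℕ => r * n) : P r m j₀ ((k : ℤ) - 2 * r) = 0 := by
  have e : ((k : ℤ) - 2 * r + 2 * r).toNat = k := by omega
  rw [P, e]
  refine shiftedPoly_eq_zero hr hj k ?_
  rintro ⟨n, rfl⟩
  exact hk ⟨n, rfl⟩

theorem G_eq_genSeries {r m : ℕ} {j₀ : ℤ} (hr : 1 ≤ r) (hj : (r : ℤ) ∣ j₀) :
    G r m j₀ = genSeries r (coeff r m j₀) := by
  funext c v
  have hinj : Function.Injective fun n : ℕ => r * n :=
    fun a b hab => Nat.eq_of_mul_eq_mul_left hr hab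
  rw [G, ← hinj.tsum_eq]
  · simp only [genSeries, coeff, Nat.cast_mul]
  · intro k hk
    by_contra hk'
    exact hk (by simp only [P_eq_zero hr hj k hk', eval_zero, zero_mul])

theorem summable_G_iff {r m : ℕ} {j₀ : ℤ} (hr : 1 ≤ r) (hj : (r : ℤ) ∣ j₀) (c v : ℂ) :
    (Summable fun n : ℕ => (coeff r m j₀ n).eval c * Complex.exp v ^ (r * n)) ↔
    Summable fun k : ℕ => (P r m j₀ ((k : ℤ) - 2 * r)).eval c * Complex.exp v ^ k := by
  have hinj : Function.Injective fun n : ℕ => r * n :=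
    fun a b hab => Nat.eq_of_mul_eq_mul_left hr hab
  refine Iff.trans ?_ (hinj.summable_iff ?_)
  · simp only [Function.comp_def, coeff, Nat.cast_mul]
  · intro k hk
    simp only [P_eq_zero hr hj k hk, eval_zero, zero_mul]

/-- Dividing the recursion at k = rn by rm gives the leading factor n + 2/m + 1/r, and this fixes s
and l. -/
theorem coeff_rec {r m : ℕ} (hr : 1 ≤ r) (hm : 1 ≤ m) (j₀ : ℤ) :
    GegenbauerRec (2 / m + 1 / r - 2) (-1 / m) (coeff r m j₀) := by
  intro n
  have hr0 : (r : ℂ) ≠ 0 := Nat.cast_ne_zero.2 (by omega)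
  have hm0 : (m : ℂ) ≠ 0 := Nat.cast_ne_zero.2 (by omega)
  have h := P_recursion r m hr j₀ (r * n) (by positivity)
  have e0 : coeff r m j₀ (n + 2) = P r m j₀ (r * n) := by
    rw [coeff]
    congr 1
    push_cast
    ring
  have e1 : coeff r m j₀ (n + 1) = P r m j₀ (r * n - r) := by
    rw [coeff]
    congr 1
    push_cast
    ring
  rw [e0, e1, coeff]
  have c0 : (n : ℂ[X]) + 2 + C (2 / m + 1 / r - 2 : ℂ)
      = C ((r * m : ℂ)⁻¹) * C (2 * r + m + ((r * n : ℤ) : ℂ) * m) := by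
    rw [← C_mul, ← map_natCast C n, ← map_ofNat C 2, ← C_add, ← C_add]
    congr 1
    push_cast
    field_simp
    ring
  have c1 : (n : ℂ[X]) + 1 + C (2 / m + 1 / r - 2 : ℂ) + C (-1 / m : ℂ)
      = C ((r * m : ℂ)⁻¹) * C (r + (1 + ((r * n : ℤ) : ℂ) - r) * m) := by
    rw [← C_mul, ← map_natCast C n, ← C_1, ← C_add, ← C_add, ← C_add]
    congr 1
    push_cast
    field_simp
    ring
  have c2 : (n : ℂ[X]) + C (2 / m + 1 / r - 2 : ℂ) + 2 * C (-1 / m : ℂ)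
      = C ((r * m : ℂ)⁻¹) * C ((((r * n : ℤ) : ℂ) - (2 * r - 1)) * m) := by
    rw [← C_mul, ← map_natCast C n, ← map_ofNat C 2, ← C_mul, ← C_add, ← C_add]
    congr 1
    push_cast
    field_simp
    ring
  rw [c0, c1, c2]
  linear_combination C ((r * m : ℂ)⁻¹) * h

theorem shift_add_ne_zero {r m : ℕ} (hr : 1 ≤ r) (hm : 1 ≤ m) (n : ℕ) :
    (n : ℂ) + 2 + (2 / m + 1 / r - 2) ≠ 0 := by
  have hr0 : (0 : ℝ) < r := Nat.cast_pos.2 (by omega)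
  have hm0 : (0 : ℝ) < m := Nat.cast_pos.2 (by omega)
  have h : ((n : ℝ) + (2 / m + 1 / r)) ≠ 0 := by positivity
  have h' : ((n : ℂ) + (2 / m + 1 / r)) ≠ 0 := by
    have := Complex.ofReal_ne_zero.2 h
    push_cast at this
    exact this
  intro h0
  exact h' (by linear_combination h0)

theorem tame_coeff {r m : ℕ} (hr : 1 ≤ r) (hm : 1 ≤ m) (j₀ : ℤ) : Tame (coeff r m j₀) :=
  tame_of_rec (shift_add_ne_zero hr hm) (coeff_rec hr hm j₀)

/-- The fourth-order equations of the coefficients. -/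
theorem assocOp_coeff {r m : ℕ} (hr : 1 ≤ r) (hm : 1 ≤ m) (n : ℕ) :
    assocOp (n + 1 / m + 1 / r - 2) (1 / m + 1 / r - 2) (-1 / m) (coeff r m (-(r : ℤ)) n) = 0 ∧
    assocOp (n + 1 / m + 1 / r - 2) (1 / m + 1 / r - 1) (-1 / m)
      (coeff r m (-2 * (r : ℤ)) n) = 0 := by
  have h0 : ∀ j₀, coeff r m j₀ 0 = if -2 * (r : ℤ) = j₀ then 1 else 0 := by
    intro j₀
    rw [coeff, P_initial _ _ _ _ (by push_cast; omega) (by push_cast; omega)]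
    simp
  have h1 : ∀ j₀, coeff r m j₀ 1 = if -(r : ℤ) = j₀ then 1 else 0 := by
    intro j₀
    have e : (r : ℤ) * ((1 : ℕ) : ℤ) - 2 * r = -r := by push_cast; ring
    rw [coeff, e, P_initial _ _ _ _ (by omega) (by omega)]
  -- The sequence for j₀ = -r starts 0, 1 and is f; the one for j₀ = -2r starts 1, 0 and is g.
  have := assocOp_fundamental (shift_add_ne_zero hr hm) (coeff_rec hr hm (-(r : ℤ)))
    (coeff_rec hr hm (-2 * (r : ℤ))) (by rw [h0, if_neg (by omega)]) (by rw [h1, if_pos rfl])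
    (by rw [h0, if_pos rfl]) (by rw [h1, if_neg (by omega)]) n
  convert this using 3 <;> ring

/-- Carries an equation for each coefficient over to the sum. Every summand must be tame, since
additivity of the series needs summability. -/
theorem equation_of_coeff {r m : ℕ} (hr : 1 ≤ r) {f : ℕ → ℂ[X]} (hf : Tame f) (a A D : ℂ)
    (h : ∀ n, C ((m : ℂ) ^ 2) * opCoeff r m a (opCoeff r m a f) n + (C A * chebyshevOp (f n)
      + C D * derivative (derivative (f n))) = 0) {c v : ℂ} (hcv : (c, v) ∈ domain r) :
    (m : ℂ) ^ 2 * gegenbauerOp r m a (gegenbauerOp r m a (genSeries r f)) c v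
      + A * ((1 - c ^ 2) * dc (dc (genSeries r f)) c v - 3 * c * dc (genSeries r f) c v
        - genSeries r f c v) + D * dc (dc (genSeries r f)) c v = 0 := by
  rw [gegenbauerOp_congr hr m a (fun _ _ => gegenbauerOp_genSeries hr m a hf) hcv,
    gegenbauerOp_genSeries hr m a (hf.map_opCoeff r m a) hcv, dc_dc_genSeries hr hf hcv,
    dc_genSeries hr hf hcv]
  have t₁ := hf.map_derivative.map_derivative.mul_left (C A * (1 - X ^ 2) + C D)
  have t₂ := hf.map_derivative.mul_left (C (-3 * A) * X)
  have t₃ := hf.mul_left (C (-A))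
  have t₄ := ((hf.map_opCoeff r m a).map_opCoeff r m a).mul_left (C ((m : ℂ) ^ 2))
  have e := genSeries_add hr t₄ (t₁.add (t₂.add t₃)) hcv
  rw [genSeries_add hr t₁ (t₂.add t₃) hcv, genSeries_add hr t₂ t₃ hcv] at e
  simp only [genSeries_mul_left] at e
  have hz : genSeries r (fun n => C ((m : ℂ) ^ 2) * opCoeff r m a (opCoeff r m a f) n +
      ((C A * (1 - X ^ 2) + C D) * derivative (derivative (f n))
      + (C (-3 * A) * X * derivative (f n) + C (-A) * f n))) c v = 0 := by
    have : ∀ n, C ((m : ℂ) ^ 2) * opCoeff r m a (opCoeff r m a f) n +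
      ((C A * (1 - X ^ 2) + C D) * derivative (derivative (f n))
      + (C (-3 * A) * X * derivative (f n) + C (-A) * f n)) = 0 := by
      intro n
      rw [← h n]
      simp only [chebyshevOp, C_mul, C_neg, map_ofNat]
      ring
    simp only [genSeries, this, eval_zero, zero_mul, tsum_zero]
  rw [hz] at e
  simp only [eval_mul, eval_add, eval_sub, eval_pow, eval_one, eval_C, eval_X] at e
  linear_combination -e

/-- Here μ = 1/m + 1/r - 2, so rmμ = m + r - 2mr, and n = 0 gives σ² - μ² = 0, whence the constant
-r². -/
theorem opCoeff_coeff_neg_r {r m : ℕ} (hr : 1 ≤ r) (hm : 1 ≤ m) (n : ℕ) :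
    C ((m : ℂ) ^ 2) * opCoeff r m (-(r : ℂ) ^ 2) (opCoeff r m (-(r : ℂ) ^ 2)
      (coeff r m (-(r : ℤ)))) n
      + (C (4 * (r : ℂ) ^ 2 * ((m : ℂ) + r - 2 * m * r) ^ 2) * chebyshevOp (coeff r m (-(r : ℤ)) n)
      + C (-4 * (r : ℂ) ^ 4 * (m + 1)) * derivative (derivative (coeff r m (-(r : ℤ)) n))) = 0 := by
  have hr0 : (r : ℂ) ≠ 0 := Nat.cast_ne_zero.2 (by omega)
  have hm0 : (m : ℂ) ≠ 0 := Nat.cast_ne_zero.2 (by omega)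
  have h := (assocOp_coeff hr hm n).1
  rw [opCoeff_opCoeff hr m _ _ n rfl]
  refine Polynomial.funext fun x => ?_
  have hx := congrArg (eval x) h
  simp only [assocOp, eval_add, eval_sub, eval_mul, eval_C, eval_zero] at hx ⊢
  linear_combination (norm := (field_simp; ring)) (m : ℂ) ^ 2 * (r : ℂ) ^ 4 * hx

/-- Here rmμ = m + r - mr and κ = (m + r - mr)², so the 4μ²Ω term accounts for every κ, and its -1
for the undifferentiated term. -/
theorem opCoeff_coeff_neg_two_r {r m : ℕ} (hr : 1 ≤ r) (hm : 1 ≤ m) (n : ℕ) {κ : ℂ}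
    (hκ : κ = ((m : ℂ) + r) ^ 2 + m * r * (-2 * r + m * (r - 2))) :
    C ((m : ℂ) ^ 2) * opCoeff r m (2 * r / m * (m * (r - 1) - r))
      (opCoeff r m (2 * r / m * (m * (r - 1) - r)) (coeff r m (-2 * (r : ℤ)))) n
      + (C (4 * (r : ℂ) ^ 2 * κ) * chebyshevOp (coeff r m (-2 * (r : ℤ)) n)
      + C (-4 * (r : ℂ) ^ 4 * (m + 1)) * derivative (derivative (coeff r m (-2 * (r : ℤ)) n))) = 0 := by
  have hr0 : (r : ℂ) ≠ 0 := Nat.cast_ne_zero.2 (by omega)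
  have hm0 : (m : ℂ) ≠ 0 := Nat.cast_ne_zero.2 (by omega)
  have h := (assocOp_coeff hr hm n).2
  rw [opCoeff_opCoeff hr m _ _ n rfl, hκ]
  refine Polynomial.funext fun x => ?_
  have hx := congrArg (eval x) h
  simp only [assocOp, eval_add, eval_sub, eval_mul, eval_C, eval_zero] at hx ⊢
  linear_combination (norm := (field_simp; ring)) (m : ℂ) ^ 2 * (r : ℂ) ^ 4 * hx

end Superelliptic

end

theorem corollary2p2 (r m : ℕ) (hr : 2 ≤ r) (hm : 2 ≤ m) :
    -- the two series converge on the domain, and their sums are holomorphic there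
    (∀ j₀ : ℤ, j₀ = -2 * (r : ℤ) ∨ j₀ = -(r : ℤ) →
      (∀ p ∈ Superelliptic.domain r, Summable fun k : ℕ =>
        (Superelliptic.P r m j₀ ((k : ℤ) - 2 * r)).eval p.1 * Complex.exp p.2 ^ k) ∧
      DifferentiableOn ℂ (fun p : ℂ × ℂ => Superelliptic.G r m j₀ p.1 p.2)
        (Superelliptic.domain r)) ∧
    -- the equation of `G_{-2r}`
    (∀ c v : ℂ, (c, v) ∈ Superelliptic.domain r →
      let G : ℂ → ℂ → ℂ := Superelliptic.G r m (-2 * (r : ℤ))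
      let B : (ℂ → ℂ → ℂ) → ℂ → ℂ → ℂ :=
        Superelliptic.gegenbauerOp r m (2 * r / m * (m * (r - 1) - r))
      0 = (m : ℂ) ^ 2 * B (B G) c v
        - 4 * (r : ℂ) ^ 2 * ((m : ℂ) * (r - 1) - r) ^ 2 * G c v
        - 12 * (r : ℂ) ^ 2 * (((m : ℂ) + r) ^ 2 + m * r * (-2 * r + m * (r - 2)))
            * c * Superelliptic.dc G c v
        + 4 * (r : ℂ) ^ 2 * (((m : ℂ) + r) ^ 2 + m * r * (-2 * r + m * (r - 2)))
            * (1 - c ^ 2) * Superelliptic.dc (Superelliptic.dc G) c v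
        - 4 * (r : ℂ) ^ 4 * (m + 1) * Superelliptic.dc (Superelliptic.dc G) c v) ∧
    -- the equation of `G_{-r}`
    (∀ c v : ℂ, (c, v) ∈ Superelliptic.domain r →
      let G : ℂ → ℂ → ℂ := Superelliptic.G r m (-(r : ℤ))
      let B : (ℂ → ℂ → ℂ) → ℂ → ℂ → ℂ :=
        Superelliptic.gegenbauerOp r m (-(r : ℂ) ^ 2)
      0 = (m : ℂ) ^ 2 * B (B G) c v
        - 4 * (r : ℂ) ^ 2 * ((m : ℂ) + r - 2 * m * r) ^ 2
            * ((c ^ 2 - 1) * Superelliptic.dc (Superelliptic.dc G) c v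
                + 3 * c * Superelliptic.dc G c v + G c v)
        - 4 * (r : ℂ) ^ 4 * (m + 1) * Superelliptic.dc (Superelliptic.dc G) c v) := by
  have hr1 : 1 ≤ r := by omega
  have hm1 : 1 ≤ m := by omega
  have d1 : (r : ℤ) ∣ -(r : ℤ) := (dvd_refl _).neg_right
  have d2 : (r : ℤ) ∣ -2 * (r : ℤ) := Dvd.intro_left _ rfl
  refine ⟨fun j₀ hj => ?_, fun c v hcv => ?_, fun c v hcv => ?_⟩
  · have hd : (r : ℤ) ∣ j₀ := by
      rcases hj with rfl | rfl
      · exact d2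
      · exact d1
    have ht := Superelliptic.tame_coeff hr1 hm1 j₀
    refine ⟨fun p hp => (Superelliptic.summable_G_iff hr1 hd p.1 p.2).1 (ht.summable hr1 hp), ?_⟩
    rw [Superelliptic.G_eq_genSeries hr1 hd]
    exact fun p hp => (ht.hasFDerivAt hr1 hp).differentiableAt.differentiableWithinAt
  · have h := Superelliptic.equation_of_coeff hr1 (Superelliptic.tame_coeff hr1 hm1 _) _ _ _
      (fun n => Superelliptic.opCoeff_coeff_neg_two_r hr1 hm1 n rfl) hcv
    rw [← Superelliptic.G_eq_genSeries hr1 d2] at h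
    intro G B
    linear_combination -h
  · have h := Superelliptic.equation_of_coeff hr1 (Superelliptic.tame_coeff hr1 hm1 _) _ _ _
      (fun n => Superelliptic.opCoeff_coeff_neg_r hr1 hm1 n) hcv
    rw [← Superelliptic.G_eq_genSeries hr1 d1] at h
    intro G B
    linear_combination -h
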